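/- Let $F$ be a field and let $\Gamma=(V,E,s,r)$ be a finite directed graph. Let $L(\Gamma)$ be its Leavitt path algebra: the $F$-algebra with generators $v\in V$ and $e,e^*$ $(e\in E)$ and relations $v_iv_j=\delta_{ij}v_i$ for $v_i,v_j\in V$; $s(e)e=er(e)=e$ and $r(e)e^*=e^*s(e)=e^*$ for $e\in E$; $e^*f=\delta_{e,f}r(e)$ for $e,f\in E$; and $v=\sum_{s(e)=v}ee^*$ for every vertex $v$ that is not a sink (its unit is $\sum_{v\in V}v$). It is $\mathbb Z$-graded by $\deg v=0$, $\deg e=1$, $\deg e^*=-1$, with homogeneous components $L(\Gamma)_i$. Vertices count as paths of length $0$, $l(p)$ is the length of a path $p$, and $(e_1\cdots e_n)^*=e_n^*\cdots e_1^*$, $v^*=v$. Let $\gamma$ be a specialization, that is, a map from the set of vertices that are not sinks to $E$ with $s(\gamma(v))=v$; the edges in its image are called special. Let $B(\gamma)\subseteq L(\Gamma)$ be the set of all products $pq^*$, where $p,q$ are paths with $r(p)=r(q)$ that do not both end with one and the same special edge. For a path $p$ let $sd(p)$ be the length of its longest final segment that consists of special edges. For real $n,s,d\ge 0$ let $V_{n,s,d}$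 be the $F$-span of all products $pq^*$ of paths $p,q$ with $l(p)+l(q)\ge n$, $sd(p)+sd(q)\le s$ and $|l(p)-l(q)|\le d$, and for $k\ge 1$ let $V_k=\sum\{V_{n,s,d}\mid n\ge k(s+d+1)\}$. Equip $L(\Gamma)$ with the topology in which the subspaces $V_k$, $k\ge1$, form a basis of neighborhoods of $0$, let $\overline{L(\Gamma)}$ be the completion, let $\overline{L(\Gamma)_i}$ be the closure of $L(\Gamma)_i$ in $\overline{L(\Gamma)}$, and let $\widehat L(\Gamma)=\sum_{i\in\mathbb Z}\overline{L(\Gamma)_i}\subseteq\overline{L(\Gamma)}$, with the induced topology. Then $B(\gamma)$ is a topological basis of $\widehat L(\Gamma)$: for every $x\in\widehat L(\Gamma)$ there is exactly one family $(\alpha_b)_{b\in B(\gamma)}$ of elements of $F$ such that the series $\sum_{b\in B(\gamma)}\alpha_b b$ converges (unconditionally, i.e. along the finite subsets of $B(\gamma)$) to $x$. -/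

import Mathlib

noncomputable section

namespace LPA

universe u v w

/-- A directed graph with vertex set `V`, edge set `E`, source map and range map. -/
structure DirGraph (V : Type u) (E : Type v) where
  src : E → V
  rng : E → V

/-- Generators of the Leavitt path algebra: the vertices `v`, the edges `e` and the ghosts `e*`. -/
inductive Gen (V : Type u) (E : Type v) where
  | vert : V → Gen V E
  | edge : E → Gen V E
  | ghost : E → Gen V E

/-- Degrees of the generators. -/
def Gen.deg {V : Type u} {E : Type v} : Gen V E → ℤ
  | .vert _ => 0
  | .edge _ => 1
  | .ghost _ => -1

namespace DirGraph

variable {V : Type u} {E : Type v} (Γ : DirGraph V E)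

/-- A sink is a vertex that emits no edge. -/
def IsSink (x : V) : Prop := ∀ e : E, Γ.src e ≠ x

/-- Paths: `⟨x, []⟩` is the vertex `x`, and `⟨x, [e₁, …, eₙ]⟩` is the path `e₁ ⋯ eₙ`, with
`x = s(e₁)`. -/
structure Path where
  source : V
  edges : List E
  source_eq : ∀ e ∈ edges.head?, Γ.src e = source
  chain : edges.IsChain (fun e f => Γ.rng e = Γ.src f)

namespace Path

variable {Γ}

/-- The length `l(p)`. -/
def length (p : Γ.Path) : ℕ := p.edges.length

/-- The range `r(p)`. -/
def range (p : Γ.Path) : V :=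
  match p.edges.getLast? with
  | none => p.source
  | some e => Γ.rng e

end Path

/-- A specialization picks, for every vertex that is not a sink, an edge that starts there. -/
structure Specialization where
  edge : {x : V // ¬ Γ.IsSink x} → E
  src_edge : ∀ x, Γ.src (edge x) = x.1

variable {Γ}

/-- Special edges: the edges in the image of the specialization. -/
def Specialization.IsSpecial (γ : Γ.Specialization) (e : E) : Prop := e ∈ Set.range γ.edge

open Classical in
/-- `sd(p)`: the length of the longest final segment of `p` that consists of special edges. -/
def Path.sd (γ : Γ.Specialization) (p : Γ.Path) : ℕ :=
  (p.edges.rtakeWhile (fun e => decide (γ.IsSpecial e))).length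

end DirGraph

variable (F : Type w) [Field F] {V : Type u} {E : Type v} [Fintype V] [Fintype E]
  (Γ : DirGraph V E)

section Relations

open FreeAlgebra

open Classical in
/-- The defining relations of the Leavitt path algebra. The algebra presented by the other
relations without a unit in the language has, the graph being finite, the unit `∑ v`; the relation
`unit` says the same for the presentation as a unital algebra. -/
inductive Rel : FreeAlgebra F (Gen V E) → FreeAlgebra F (Gen V E) → Prop
  | vert_idem (x : V) : Rel (ι F (.vert x) * ι F (.vert x)) (ι F (.vert x))
  | vert_orth (x y : V) : x ≠ y → Rel (ι F (.vert x) * ι F (.vert y)) 0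
  | src_edge (e : E) : Rel (ι F (.vert (Γ.src e)) * ι F (.edge e)) (ι F (.edge e))
  | edge_rng (e : E) : Rel (ι F (.edge e) * ι F (.vert (Γ.rng e))) (ι F (.edge e))
  | rng_ghost (e : E) : Rel (ι F (.vert (Γ.rng e)) * ι F (.ghost e)) (ι F (.ghost e))
  | ghost_src (e : E) : Rel (ι F (.ghost e) * ι F (.vert (Γ.src e))) (ι F (.ghost e))
  | ghost_edge (e : E) : Rel (ι F (.ghost e) * ι F (.edge e)) (ι F (.vert (Γ.rng e)))
  | ghost_edge_ne (e f : E) : e ≠ f → Rel (ι F (.ghost e) * ι F (.edge f)) 0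
  | vert_eq_sum (x : V) : ¬ Γ.IsSink x →
      Rel (ι F (.vert x)) (∑ e ∈ Finset.univ.filter (fun e : E => Γ.src e = x),
        ι F (.edge e) * ι F (.ghost e))
  | unit : Rel (∑ x : V, ι F (.vert x)) 1

end Relations

/-- The Leavitt path algebra `L(Γ)` over the field `F`. The specialization `γ` plays no role in the
algebra; it is recorded in the name of the type because the topology depends on it. -/
def Leavitt (_γ : Γ.Specialization) : Type (max u v w) := RingQuot (Rel F Γ)

variable {Γ} (γ : Γ.Specialization)

instance : Ring (Leavitt F Γ γ) := inferInstanceAs (Ring (RingQuot (Rel F Γ)))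

instance : Algebra F (Leavitt F Γ γ) := inferInstanceAs (Algebra F (RingQuot (Rel F Γ)))

/-- The canonical map from the free algebra. -/
def mk : FreeAlgebra F (Gen V E) →ₐ[F] Leavitt F Γ γ := RingQuot.mkAlgHom F (Rel F Γ)

/-- The image of a generator in `L(Γ)`. -/
def gen (g : Gen V E) : Leavitt F Γ γ := mk F γ (FreeAlgebra.ι F g)

/-- The image in `L(Γ)` of a word in the generators. -/
def word (l : List (Gen V E)) : Leavitt F Γ γ := (l.map (gen F γ)).prod

/-- The word `s(p) e₁ ⋯ eₙ`, which represents the path `p = e₁ ⋯ eₙ`. -/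
def pathWord (p : Γ.Path) : List (Gen V E) := .vert p.source :: p.edges.map .edge

/-- The word `eₙ* ⋯ e₁* s(p)`, which represents `p*` for `p = e₁ ⋯ eₙ`. -/
def ghostWord (p : Γ.Path) : List (Gen V E) := p.edges.reverse.map .ghost ++ [.vert p.source]

/-- The element `p q*` of `L(Γ)`. -/
def monomial (p q : Γ.Path) : Leavitt F Γ γ := word F γ (pathWord p) * word F γ (ghostWord q)

/-- The set `B(γ)`: the products `p q*` with `r(p) = r(q)` such that `p` and `q` do not end with
the same special edge. -/
def B : Set (Leavitt F Γ γ) :=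
  {b | ∃ p q : Γ.Path, p.range = q.range ∧
    (∀ e, p.edges.getLast? = some e → q.edges.getLast? = some e → ¬ γ.IsSpecial e) ∧
    b = monomial F γ p q}

/-- The subspace `V_{n,s,d}`. -/
def Vnsd (n s d : ℝ) : Submodule F (Leavitt F Γ γ) :=
  Submodule.span F {a | ∃ p q : Γ.Path,
    n ≤ (p.length : ℝ) + (q.length : ℝ) ∧ (p.sd γ : ℝ) + (q.sd γ : ℝ) ≤ s ∧
    |(p.length : ℝ) - (q.length : ℝ)| ≤ d ∧ a = monomial F γ p q}

/-- The subspace `V_k`: the sum of the `V_{n,s,d}` with `n, s, d ≥ 0` and `n ≥ k (s + d + 1)`. -/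
def Vk (k : ℝ) : Submodule F (Leavitt F Γ γ) :=
  ⨆ t : {t : ℝ × ℝ × ℝ // 0 ≤ t.1 ∧ 0 ≤ t.2.1 ∧ 0 ≤ t.2.2 ∧ k * (t.2.1 + t.2.2 + 1) ≤ t.1},
    Vnsd F γ t.1.1 t.1.2.1 t.1.2.2

theorem Vk_anti {k l : ℝ} (h : k ≤ l) : Vk F γ l ≤ Vk F γ k := by
  refine iSup_le fun t => ?_
  obtain ⟨⟨n, s, d⟩, hn, hs, hd, ht⟩ := t
  simp only at hn hs hd ht
  refine le_iSup_of_le (ι := {t : ℝ × ℝ × ℝ //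
    0 ≤ t.1 ∧ 0 ≤ t.2.1 ∧ 0 ≤ t.2.2 ∧ k * (t.2.1 + t.2.2 + 1) ≤ t.1})
    ⟨(n, s, d), hn, hs, hd, ?_⟩ le_rfl
  simp only
  nlinarith

/-- The filter basis of neighbourhoods of `0` formed by the subspaces `V_k`, `k ≥ 1`. -/
@[reducible] def nhdsBasis : AddGroupFilterBasis (Leavitt F Γ γ) where
  sets := {U | ∃ k : ℝ, 1 ≤ k ∧ U = (Vk F γ k : Set (Leavitt F Γ γ))}
  nonempty := ⟨_, 1, le_rfl, rfl⟩
  inter_sets := by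
    rintro _ _ ⟨k, hk, rfl⟩ ⟨l, hl, rfl⟩
    exact ⟨_, ⟨max k l, le_trans hk (le_max_left _ _), rfl⟩,
      fun x hx => ⟨Vk_anti F γ (le_max_left _ _) hx, Vk_anti F γ (le_max_right _ _) hx⟩⟩
  zero' := by
    rintro _ ⟨k, -, rfl⟩
    exact (Vk F γ k).zero_mem
  add' := by
    rintro _ ⟨k, hk, rfl⟩
    refine ⟨_, ⟨k, hk, rfl⟩, ?_⟩
    rintro _ ⟨x, hx, y, hy, rfl⟩
    exact (Vk F γ k).add_mem hx hy
  neg' := by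
    rintro _ ⟨k, hk, rfl⟩
    exact ⟨_, ⟨k, hk, rfl⟩, fun x hx => (Vk F γ k).neg_mem hx⟩
  conj' := by
    rintro x _ ⟨k, hk, rfl⟩
    refine ⟨_, ⟨k, hk, rfl⟩, fun y hy => ?_⟩
    simpa using hy

/-- The topology of `L(Γ)` that is determined by `γ`. -/
instance : TopologicalSpace (Leavitt F Γ γ) := (nhdsBasis F γ).topology

instance : IsTopologicalAddGroup (Leavitt F Γ γ) := (nhdsBasis F γ).isTopologicalAddGroup

instance : UniformSpace (Leavitt F Γ γ) := IsTopologicalAddGroup.rightUniformSpace _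

instance : IsUniformAddGroup (Leavitt F Γ γ) := isUniformAddGroup_of_addCommGroup

theorem nhds_zero_hasBasis :
    (nhds (0 : Leavitt F Γ γ)).HasBasis (fun k : ℝ => 1 ≤ k)
      (fun k => (Vk F γ k : Set (Leavitt F Γ γ))) := by
  refine ⟨fun U => ?_⟩
  rw [(nhdsBasis F γ).nhds_zero_hasBasis.mem_iff]
  constructor
  · rintro ⟨_, ⟨k, hk, rfl⟩, h⟩
    exact ⟨k, hk, h⟩
  · rintro ⟨k, hk, h⟩
    exact ⟨_, ⟨k, hk, rfl⟩, h⟩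

instance : UniformContinuousConstSMul F (Leavitt F Γ γ) where
  uniformContinuous_const_smul c := by
    refine uniformContinuous_of_continuousAt_zero (DistribSMul.toAddMonoidHom _ c) ?_
    rw [ContinuousAt, map_zero]
    refine ((nhds_zero_hasBasis F γ).tendsto_iff (nhds_zero_hasBasis F γ)).2 fun k hk => ?_
    exact ⟨k, hk, fun x hx => (Vk F γ k).smul_mem c hx⟩

/-- The completion of `L(Γ)`. -/
abbrev Compl : Type (max u v w) := UniformSpace.Completion (Leavitt F Γ γ)

/-- The canonical map of `L(Γ)` to its completion. -/
def toCompl : Leavitt F Γ γ →ₗ[F] Compl F γ where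
  toFun a := (a : UniformSpace.Completion (Leavitt F Γ γ))
  map_add' := UniformSpace.Completion.coe_add
  map_smul' c a := UniformSpace.Completion.coe_smul c a

/-- The homogeneous component of degree `i`: the span of the words of degree `i` in the
generators. -/
def homog (i : ℤ) : Submodule F (Leavitt F Γ γ) :=
  Submodule.span F {a | ∃ l : List (Gen V E), (l.map Gen.deg).sum = i ∧ a = word F γ l}

/-- The completion of the component of degree `i`: its closure in the completion of `L(Γ)`. -/
def complHomog (i : ℤ) : Submodule F (Compl F γ) :=
  ((homog F γ i).map (toCompl F γ)).topologicalClosure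

/-- The graded completion: the sum of the completed homogeneous components, a subspace of the
completion of `L(Γ)` with the subspace topology. -/
def gradedCompl : Submodule F (Compl F γ) := ⨆ i : ℤ, complHomog F γ i

theorem word_mem_gradedCompl (l : List (Gen V E)) :
    toCompl F γ (word F γ l) ∈ gradedCompl F γ := by
  refine Submodule.mem_iSup_of_mem (l.map Gen.deg).sum ?_
  exact Submodule.le_topologicalClosure _
    (Submodule.mem_map_of_mem (Submodule.subset_span ⟨l, rfl, rfl⟩))

theorem mk_mul_mem_span_word (x : FreeAlgebra F (Gen V E)) (y : Leavitt F Γ γ)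
    (hy : y ∈ Submodule.span F (Set.range (word F γ))) :
    mk F γ x * y ∈ Submodule.span F (Set.range (word F γ)) := by
  induction x using FreeAlgebra.induction generalizing y with
  | grade0 c =>
    rw [AlgHom.commutes, ← Algebra.smul_def]
    exact Submodule.smul_mem _ _ hy
  | grade1 g =>
    induction hy using Submodule.span_induction with
    | mem y hy =>
      obtain ⟨l, rfl⟩ := hy
      exact Submodule.subset_span ⟨g :: l, by simp [word, gen]⟩
    | zero => simp
    | add y z _ _ hy hz => rw [mul_add]; exact Submodule.add_mem _ hy hz
    | smul c y _ hy => rw [mul_smul_comm]; exact Submodule.smul_mem _ _ hy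
  | add a b ha hb =>
    rw [map_add, add_mul]
    exact Submodule.add_mem _ (ha y hy) (hb y hy)
  | mul a b ha hb =>
    rw [map_mul, mul_assoc]
    exact ha _ (hb y hy)

theorem toCompl_mem (a : Leavitt F Γ γ) : toCompl F γ a ∈ gradedCompl F γ := by
  obtain ⟨x, rfl⟩ := RingQuot.mkAlgHom_surjective F (Rel F Γ) a
  have h := mk_mul_mem_span_word F γ x 1 (Submodule.subset_span ⟨[], rfl⟩)
  rw [mul_one] at h
  have hle : Submodule.span F (Set.range (word F γ)) ≤
      (gradedCompl F γ).comap (toCompl F γ) := by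
    rw [Submodule.span_le]
    rintro _ ⟨l, rfl⟩
    exact word_mem_gradedCompl F γ l
  exact hle h

/-- The canonical map of `L(Γ)` to its graded completion. -/
def toGradedCompl : Leavitt F Γ γ →ₗ[F] gradedCompl F γ :=
  (toCompl F γ).codRestrict (gradedCompl F γ) (toCompl_mem F γ)

end LPA

end

/-! The set `B(γ)` is a basis of the vector space `L(Γ)`, every `V_k` is a coordinate subspace with
respect to this basis, and every `b ∈ B(γ)` lies outside some `V_k`. So each coordinate is continuous
for the discrete topology of `F` and extends to the completion. Applied to a convergent series, the
extended coordinates return its coefficients, which gives uniqueness (`eq_coord_of_hasSum`).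
Conversely, modulo the closure of `V_k` every `x` in the completion equals some `a ∈ L(Γ)`, and the
coordinates of `x` and `a` outside `V_k` agree; hence the series of the coordinates of `x` converges
to `x` (`hasSum_coord`). This holds in the whole completion, in particular in the graded one.

Linear independence of `B(γ)` (`linearIndependent_monomial`) is read off from a representation of
`L(Γ)` on the space spanned by the infinite or maximal paths that are eventually special, labelled by
integers. The matrix coefficients of `p q*` are `0` or `1`, and a coefficient chosen at the special
path that starts at `r(p)` isolates `p q*` among the elements of `B(γ)` that are not shorter.

For spanning, the relation `x = ∑ e e*` rewrites a product `p g (q g)*` with a special edge `g` in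
terms of `p q*` and of products in `B(γ)`. Since `k ≥ 1`, the rewriting does not lead out of the
spanning set of `V_k`; so it also shows that `V_k` is a coordinate subspace
(`monomial_mem_span_isBasic`, `Vk_eq_span`). -/

noncomputable section

namespace LPA

universe u v w

/-! ### Eventually special paths -/

section Representation

variable {F : Type w} [Field F] {V : Type u} {E : Type v} {Γ : DirGraph V E}

theorem DirGraph.Specialization.IsSpecial.eq_edge {γ : Γ.Specialization} {e : E}
    (he : γ.IsSpecial e) (h : ¬ Γ.IsSink (Γ.src e)) : γ.edge ⟨Γ.src e, h⟩ = e := by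
  obtain ⟨x, rfl⟩ := he
  congr 1
  exact Subtype.ext (γ.src_edge x)

theorem DirGraph.Specialization.IsSpecial.eq_of_src_eq {γ : Γ.Specialization} {e f : E}
    (he : γ.IsSpecial e) (hf : γ.IsSpecial f) (h : Γ.src e = Γ.src f) : e = f := by
  have hs : ¬ Γ.IsSink (Γ.src f) := fun h' => h' f rfl
  have hs' : ¬ Γ.IsSink (Γ.src e) := fun h' => h' e rfl
  rw [← he.eq_edge hs', ← hf.eq_edge hs]
  congr 1
  exact Subtype.ext h

/-- `IsReduced γ x l` says that `l` is the list of edges of a path which starts at `x` and which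
does not end with a special edge. -/
def IsReduced (γ : Γ.Specialization) : V → List E → Prop
  | _, [] => True
  | x, e :: l => Γ.src e = x ∧ (l = [] → ¬ γ.IsSpecial e) ∧ IsReduced γ (Γ.rng e) l

theorem isReduced_nil (γ : Γ.Specialization) (x : V) : IsReduced γ x [] := by
  simp [IsReduced]

theorem isReduced_cons {γ : Γ.Specialization} {x : V} {e : E} {l : List E} :
    IsReduced γ x (e :: l) ↔ Γ.src e = x ∧ (l = [] → ¬ γ.IsSpecial e) ∧ IsReduced γ (Γ.rng e) l := by
  simp [IsReduced]

/-- An eventually special path, with an integer label. The path follows `edges` and from their end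
on it follows the special edges, until it reaches a sink or forever; all special edges at its end
belong to this tail, so that `edges` does not end with a special one. The label makes the operators
below homogeneous. -/
@[ext]
structure EventualPath (γ : Γ.Specialization) where
  source : V
  edges : List E
  label : ℤ
  reduced : IsReduced γ source edges

variable {γ : Γ.Specialization}

open Classical in
/-- The partial maps by which the generators act on eventually special paths: a vertex is the
identity on the paths that start there, an edge is put in front of a path, a ghost edge removes the
first edge. -/
def act : Gen V E → EventualPath γ → Option (EventualPath γ)
  | .vert v, x => if x.source = v then some x else none
  | .edge e, x =>
    if h : x.source = Γ.rng e then
      if h' : x.edges = [] ∧ γ.IsSpecial e then some ⟨Γ.src e, [], x.label + 1, isReduced_nil γ _⟩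
      else some ⟨Γ.src e, e :: x.edges, x.label + 1,
        isReduced_cons.2 ⟨rfl, fun h₁ h₂ => h' ⟨h₁, h₂⟩, h ▸ x.reduced⟩⟩
    else none
  | .ghost e, ⟨v, [], n, _⟩ =>
    if v = Γ.src e ∧ γ.IsSpecial e then some ⟨Γ.rng e, [], n - 1, isReduced_nil γ _⟩ else none
  | .ghost e, ⟨_, f :: l, n, h⟩ =>
    if h' : f = e then some ⟨Γ.rng e, l, n - 1, h' ▸ (isReduced_cons.1 h).2.2⟩ else none

theorem act_vert_eq_some {v : V} {x y : EventualPath γ} :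
    act (.vert v) x = some y ↔ x.source = v ∧ x = y := by
  simp [act]

theorem act_edge_source {e : E} {x y : EventualPath γ} (h : act (.edge e) x = some y) :
    x.source = Γ.rng e ∧ y.source = Γ.src e ∧ y.label = x.label + 1 := by
  simp only [act] at h
  split_ifs at h with h₁ h₂ <;> cases h <;> exact ⟨h₁, rfl, rfl⟩

theorem act_edge_isSome {e : E} {x : EventualPath γ} (h : x.source = Γ.rng e) :
    ∃ y, act (.edge e) x = some y := by
  simp only [act]
  split_ifs <;> exact ⟨_, rfl⟩

/-- The partial maps of `e` and of `e*` are inverse to each other. -/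
theorem act_ghost_eq_some {e : E} {x y : EventualPath γ} :
    act (.ghost e) x = some y ↔ act (.edge e) y = some x := by
  obtain ⟨v, l, n, hx⟩ := x
  obtain ⟨w, m, k, hy⟩ := y
  cases l with
  | nil =>
    simp only [act, Option.ite_none_right_eq_some, Option.some.injEq, EventualPath.ext_iff]
    constructor
    · rintro ⟨⟨rfl, h⟩, rfl, rfl, rfl⟩
      simp [h]
    · intro h
      split_ifs at h with h₁ h₂
      · simp only [Option.some.injEq, EventualPath.ext_iff] at h
        obtain ⟨rfl, -, rfl⟩ := h
        exact ⟨⟨rfl, h₂.2⟩, h₁.symm, h₂.1.symm, by ring⟩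
      · simp at h
  | cons f l =>
    simp only [act]
    constructor
    · intro h
      split_ifs at h with h₁
      subst h₁
      simp only [Option.some.injEq, EventualPath.ext_iff] at h
      obtain ⟨rfl, rfl, rfl⟩ := h
      rw [dif_pos rfl, dif_neg fun h' => (isReduced_cons.1 hx).2.1 h'.1 h'.2]
      simp [(isReduced_cons.1 hx).1]
    · intro h
      split_ifs at h with h₁ h₂
      · simp at h
      · simp only [Option.some.injEq, EventualPath.ext_iff, List.cons.injEq] at h
        obtain ⟨rfl, ⟨rfl, rfl⟩, rfl⟩ := h
        simp [h₁]

theorem act_edge_unique {e f : E} {x y z : EventualPath γ} (h : act (.edge e) x = some z)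
    (h' : act (.edge f) y = some z) : e = f ∧ x = y := by
  have hef : e = f := by
    have h₁ := act_ghost_eq_some.2 h
    have h₂ := act_ghost_eq_some.2 h'
    obtain ⟨v, l, n, hz⟩ := z
    cases l with
    | nil =>
      simp only [act, Option.ite_none_right_eq_some] at h₁ h₂
      exact h₁.1.2.eq_of_src_eq h₂.1.2 (h₁.1.1.symm.trans h₂.1.1)
    | cons g l =>
      simp only [act, Option.dite_none_right_eq_some] at h₁ h₂
      exact h₁.1.symm.trans h₂.1
  subst hef
  rw [← act_ghost_eq_some] at h h'
  exact ⟨rfl, Option.some.inj (h.symm.trans h')⟩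

/-- Every eventually special path that starts at a vertex which is not a sink has a first edge. -/
theorem exists_act_edge_eq {x : EventualPath γ} (hx : ¬ Γ.IsSink x.source) :
    ∃ e y, act (.edge e) y = some x := by
  obtain ⟨v, l, n, h⟩ := x
  cases l with
  | nil =>
    refine ⟨γ.edge ⟨v, hx⟩, ⟨Γ.rng (γ.edge ⟨v, hx⟩), [], n - 1, isReduced_nil γ _⟩, ?_⟩
    rw [← act_ghost_eq_some]
    simp only [act]
    exact if_pos ⟨(γ.src_edge ⟨v, hx⟩).symm, _, rfl⟩
  | cons e l =>
    refine ⟨e, ⟨Γ.rng e, l, n - 1, (isReduced_cons.1 h).2.2⟩, ?_⟩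
    rw [← act_ghost_eq_some]
    simp [act]

/-- If an edge maps `y` to a path that is special from the start, then the edge is special and `y`
is special from the start as well. -/
theorem act_edge_eq_special {e : E} {x y : EventualPath γ} (h : act (.edge e) y = some x)
    (hx : x.edges = []) : γ.IsSpecial e ∧ y.edges = [] := by
  simp only [act] at h
  split_ifs at h with h₁ h₂
  · exact h₂.symm
  · cases h
    simp at hx

/-! ### The representation on eventually special paths -/

variable (F) in
/-- The linear operator given by a partial map of a basis. -/
def partialOp {X : Type*} (φ : X → Option X) : Module.End F (X →₀ F) :=
  Finsupp.linearCombination F fun x => (φ x).elim 0 fun y => Finsupp.single y 1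

theorem partialOp_single {X : Type*} (φ : X → Option X) (x : X) :
    partialOp F φ (Finsupp.single x 1) = (φ x).elim 0 fun y => Finsupp.single y 1 := by
  simp [partialOp]

theorem partialOp_mul {X : Type*} (φ ψ : X → Option X) :
    partialOp F φ * partialOp F ψ = partialOp F fun x => (ψ x).bind φ := by
  refine Finsupp.lhom_ext' fun x => LinearMap.ext_ring ?_
  simp only [LinearMap.coe_comp, Function.comp_apply, Finsupp.lsingle_apply, Module.End.mul_apply,
    partialOp_single]
  cases ψ x <;> simp [partialOp_single]

theorem partialOp_none {X : Type*} : partialOp F (fun _ : X => none) = 0 := by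
  refine Finsupp.lhom_ext' fun x => LinearMap.ext_ring ?_
  simp [partialOp_single]

theorem partialOp_some {X : Type*} : partialOp F (fun x : X => some x) = 1 := by
  refine Finsupp.lhom_ext' fun x => LinearMap.ext_ring ?_
  simp [partialOp_single]

theorem act_edge_bind_ghost (e f : E) (x : EventualPath γ) (y : EventualPath γ) :
    (act (.edge f) x).bind (act (.ghost e)) = some y ↔ e = f ∧ x = y ∧ x.source = Γ.rng f := by
  rw [Option.bind_eq_some_iff]
  constructor
  · rintro ⟨z, h, h'⟩
    obtain ⟨rfl, rfl⟩ := act_edge_unique (act_ghost_eq_some.1 h') h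
    exact ⟨rfl, rfl, (act_edge_source h).1⟩
  · rintro ⟨rfl, rfl, h⟩
    obtain ⟨z, hz⟩ := act_edge_isSome h
    exact ⟨z, hz, act_ghost_eq_some.2 hz⟩

variable [Fintype V] [Fintype E]

variable (F γ) in
/-- The operators given by the generators satisfy the defining relations. -/
theorem lift_act_rel {a b : FreeAlgebra F (Gen V E)} (h : Rel F Γ a b) :
    FreeAlgebra.lift F (fun g => partialOp F (act (γ := γ) g)) a =
      FreeAlgebra.lift F (fun g => partialOp F (act (γ := γ) g)) b := by
  classical
  induction h with
  | vert_idem v =>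
    simp only [map_mul, FreeAlgebra.lift_ι_apply, partialOp_mul]
    congr 1
    ext x y
    simp only [Option.bind_eq_some_iff, act_vert_eq_some]
    grind
  | vert_orth v w hvw =>
    simp only [map_mul, FreeAlgebra.lift_ι_apply, partialOp_mul, map_zero]
    rw [← partialOp_none]
    congr 1
    ext x y
    simp only [Option.bind_eq_some_iff, act_vert_eq_some, reduceCtorEq, iff_false]
    rintro ⟨z, ⟨rfl, rfl⟩, h, -⟩
    exact hvw h.symm
  | src_edge e =>
    simp only [map_mul, FreeAlgebra.lift_ι_apply, partialOp_mul]
    congr 1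
    ext x y
    simp only [Option.bind_eq_some_iff, act_vert_eq_some]
    constructor
    · rintro ⟨z, h, -, rfl⟩
      exact h
    · intro h
      exact ⟨y, h, (act_edge_source h).2.1, rfl⟩
  | edge_rng e =>
    simp only [map_mul, FreeAlgebra.lift_ι_apply, partialOp_mul]
    congr 1
    ext x y
    simp only [Option.bind_eq_some_iff, act_vert_eq_some]
    constructor
    · rintro ⟨z, ⟨-, rfl⟩, h⟩
      exact h
    · intro h
      exact ⟨x, ⟨(act_edge_source h).1, rfl⟩, h⟩
  | rng_ghost e =>
    simp only [map_mul, FreeAlgebra.lift_ι_apply, partialOp_mul]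
    congr 1
    ext x y
    simp only [Option.bind_eq_some_iff, act_vert_eq_some]
    constructor
    · rintro ⟨z, h, -, rfl⟩
      exact h
    · intro h
      exact ⟨y, h, (act_edge_source (act_ghost_eq_some.1 h)).1, rfl⟩
  | ghost_src e =>
    simp only [map_mul, FreeAlgebra.lift_ι_apply, partialOp_mul]
    congr 1
    ext x y
    simp only [Option.bind_eq_some_iff, act_vert_eq_some]
    constructor
    · rintro ⟨z, ⟨-, rfl⟩, h⟩
      exact h
    · intro h
      exact ⟨x, ⟨(act_edge_source (act_ghost_eq_some.1 h)).2.1, rfl⟩, h⟩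
  | ghost_edge e =>
    simp only [map_mul, FreeAlgebra.lift_ι_apply, partialOp_mul]
    congr 1
    ext x y
    rw [act_edge_bind_ghost, act_vert_eq_some]
    tauto
  | ghost_edge_ne e f hef =>
    simp only [map_mul, FreeAlgebra.lift_ι_apply, partialOp_mul, map_zero]
    rw [← partialOp_none]
    congr 1
    ext x y
    rw [act_edge_bind_ghost]
    simp [hef]
  | vert_eq_sum v hv =>
    simp only [map_mul, map_sum, FreeAlgebra.lift_ι_apply, partialOp_mul]
    refine Finsupp.lhom_ext' fun x => LinearMap.ext_ring ?_
    simp only [LinearMap.coe_comp, Function.comp_apply, Finsupp.lsingle_apply,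
      LinearMap.sum_apply, partialOp_single]
    have key : ∀ e : E, e ∈ Finset.univ.filter (fun e : E => Γ.src e = v) →
        (∀ y, ¬ act (.edge e) y = some x) →
        ((act (.ghost e) x).bind (act (.edge e))).elim (0 : EventualPath γ →₀ F)
          (fun y => Finsupp.single y 1) = 0 := by
      intro e _ he
      cases h : act (.ghost e) x with
      | none => rfl
      | some y => exact absurd (act_ghost_eq_some.1 h) (he y)
    by_cases hx : x.source = v
    · obtain ⟨e, y, hy⟩ := exists_act_edge_eq (x := x) (hx ▸ hv)
      have hsrc := (act_edge_source hy).2.1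
      rw [Finset.sum_eq_single_of_mem e (by simp [← hx, hsrc]), act_ghost_eq_some.2 hy]
      · rw [Option.bind_some, hy]
        simp [act, hx]
      · exact fun f hf hfe => key f hf fun z hz => hfe (act_edge_unique hz hy).1
    · rw [Finset.sum_eq_zero]
      · simp [act, hx]
      · refine fun f hf => key f hf fun z hz => hx ?_
        rw [(act_edge_source hz).2.1]
        simpa using hf
  | unit =>
    simp only [map_sum, FreeAlgebra.lift_ι_apply, map_one]
    refine Finsupp.lhom_ext' fun x => LinearMap.ext_ring ?_
    simp only [LinearMap.coe_comp, Function.comp_apply, Finsupp.lsingle_apply,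
      LinearMap.sum_apply, partialOp_single, Module.End.one_apply]
    rw [Finset.sum_eq_single_of_mem x.source (Finset.mem_univ _)]
    · simp [act]
    · intro v _ hv
      simp [act, hv.symm]

variable (F γ) in
/-- The representation of the Leavitt path algebra on the space with the eventually special paths
as a basis. -/
def rep : Leavitt F Γ γ →ₐ[F] Module.End F (EventualPath γ →₀ F) :=
  RingQuot.liftAlgHom F ⟨FreeAlgebra.lift F fun g => partialOp F (act g),
    fun _ _ h => lift_act_rel F γ h⟩

theorem rep_gen (g : Gen V E) : rep F γ (gen F γ g) = partialOp F (act g) := by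
  rw [rep, gen, mk]
  exact (RingQuot.liftAlgHom_mkAlgHom_apply F _ _ _).trans (FreeAlgebra.lift_ι_apply _ _)

/-- The partial map by which a word in the generators acts. -/
def wordAct : List (Gen V E) → EventualPath γ → Option (EventualPath γ)
  | [], x => some x
  | g :: l, x => (wordAct l x).bind (act g)

omit [Fintype V] [Fintype E] in
theorem wordAct_append (l m : List (Gen V E)) (x : EventualPath γ) :
    wordAct (l ++ m) x = (wordAct m x).bind (wordAct l) := by
  induction l with
  | nil => simp [wordAct]
  | cons g l ih =>
    simp only [List.cons_append, wordAct, ih]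
    cases wordAct m x <;> simp

theorem rep_word (l : List (Gen V E)) : rep F γ (word F γ l) = partialOp F (wordAct l) := by
  induction l with
  | nil => exact (map_one _).trans partialOp_some.symm
  | cons g l ih =>
    simp only [word, List.map_cons, List.prod_cons, map_mul] at ih ⊢
    rw [ih, rep_gen, partialOp_mul]
    rfl

omit [Fintype V] [Fintype E] in
theorem wordAct_ghostWord_eq_some {q : Γ.Path} {x y : EventualPath γ} :
    wordAct (ghostWord q) x = some y ↔ wordAct (pathWord q) y = some x := by
  have key : ∀ (l : List E) (x y : EventualPath γ),
      wordAct (l.reverse.map .ghost) x = some y ↔ wordAct (l.map .edge) y = some x := by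
    intro l
    induction l with
    | nil => simp [wordAct, eq_comm]
    | cons e l ih =>
      intro x y
      simp only [List.reverse_cons, List.map_append, wordAct_append, List.map_cons, List.map_nil,
        wordAct, Option.bind_some, Option.bind_eq_some_iff, act_ghost_eq_some, ih]
      exact exists_congr fun _ => and_comm
  simp only [ghostWord, pathWord, wordAct_append, wordAct, Option.bind_some,
    Option.bind_eq_some_iff, act_vert_eq_some, key]
  constructor
  · rintro ⟨z, ⟨h, rfl⟩, h'⟩
    exact ⟨x, h', h, rfl⟩
  · rintro ⟨z, h', h, rfl⟩
    exact ⟨z, ⟨h, rfl⟩, h'⟩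

/-- The matrix coefficient of `p q*` at `(x, z)` is `1` or `0`. It is `1` precisely when `x = q y`
and `z = p y` for some `y`. -/
theorem rep_monomial_apply (p q : Γ.Path) (x z : EventualPath γ) :
    (∃ y, wordAct (pathWord q) y = some x ∧ wordAct (pathWord p) y = some z) ∧
        rep F γ (monomial F γ p q) (Finsupp.single x 1) z = 1 ∨
      (¬ ∃ y, wordAct (pathWord q) y = some x ∧ wordAct (pathWord p) y = some z) ∧
        rep F γ (monomial F γ p q) (Finsupp.single x 1) z = 0 := by
  simp only [monomial, map_mul, rep_word, partialOp_mul, partialOp_single,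
    ← wordAct_ghostWord_eq_some (q := q), ← Option.bind_eq_some_iff]
  cases h : (wordAct (ghostWord q) x).bind (wordAct (pathWord p)) with
  | none => right; simp
  | some y =>
    by_cases hy : y = z
    · left; simp [hy]
    · right; simp [hy]

/-! ### Linear independence -/

omit [Fintype V] [Fintype E] in
theorem wordAct_edges_label {l : List E} {x y : EventualPath γ}
    (h : wordAct (l.map .edge) x = some y) : y.label = x.label + l.length := by
  induction l generalizing y with
  | nil => simp_all [wordAct]
  | cons e l ih =>
    obtain ⟨z, hz, h⟩ := Option.bind_eq_some_iff.1 h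
    rw [(act_edge_source h).2.2, ih hz]
    push_cast [List.length_cons]
    ring

omit [Fintype V] [Fintype E] in
theorem wordAct_pathWord_eq_some {p : Γ.Path} {x y : EventualPath γ} :
    wordAct (pathWord p) x = some y ↔
      wordAct (p.edges.map .edge) x = some y ∧ y.source = p.source := by
  simp only [pathWord, wordAct, Option.bind_eq_some_iff, act_vert_eq_some]
  constructor
  · rintro ⟨z, h, h', rfl⟩
    exact ⟨h, h'⟩
  · rintro ⟨h, h'⟩
    exact ⟨y, h, h', rfl⟩

omit [Fintype V] [Fintype E] in
/-- If `l a = m b` as eventually special paths and `m` is at least as long as `l`, then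
`m = l u` and `a = u b` for some `u`. -/
theorem exists_append_of_wordAct_eq {l m : List E} {a b x : EventualPath γ}
    (hlm : l.length ≤ m.length) (hl : wordAct (l.map .edge) a = some x)
    (hm : wordAct (m.map .edge) b = some x) :
    ∃ u, m = l ++ u ∧ wordAct (u.map .edge) b = some a := by
  induction l generalizing m x with
  | nil =>
    obtain rfl : a = x := by simpa [wordAct] using hl
    exact ⟨m, rfl, hm⟩
  | cons e l ih =>
    cases m with
    | nil => simp at hlm
    | cons f m =>
      obtain ⟨y, hy, hl⟩ := Option.bind_eq_some_iff.1 hl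
      obtain ⟨z, hz, hm⟩ := Option.bind_eq_some_iff.1 hm
      obtain ⟨rfl, rfl⟩ := act_edge_unique hl hm
      obtain ⟨u, rfl, hu⟩ := ih (by simpa using hlm) hy hz
      exact ⟨u, rfl, hu⟩

omit [Fintype V] [Fintype E] in
/-- Two initial segments of equal length of a path that is special from the start are equal and
consist of special edges. -/
theorem eq_of_wordAct_eq_special {l m : List E} {b b' x : EventualPath γ} (hx : x.edges = [])
    (hlm : l.length = m.length) (hl : wordAct (l.map .edge) b = some x)
    (hm : wordAct (m.map .edge) b' = some x) : l = m ∧ ∀ e ∈ l, γ.IsSpecial e := by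
  induction l generalizing m x with
  | nil => simp_all [eq_comm]
  | cons e l ih =>
    cases m with
    | nil => simp at hlm
    | cons f m =>
      obtain ⟨y, hy, hl⟩ := Option.bind_eq_some_iff.1 hl
      obtain ⟨z, hz, hm⟩ := Option.bind_eq_some_iff.1 hm
      obtain ⟨rfl, rfl⟩ := act_edge_unique hl hm
      obtain ⟨he, hy'⟩ := act_edge_eq_special hl hx
      obtain ⟨rfl, h⟩ := ih hy' (by simpa using hlm) hy hz
      exact ⟨rfl, by simpa using ⟨he, h⟩⟩

omit [Fintype V] [Fintype E] in
theorem DirGraph.Path.ext {p q : Γ.Path} (h : p.source = q.source) (h' : p.edges = q.edges) :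
    p = q := by
  cases p
  cases q
  simp_all

omit [Fintype V] [Fintype E] in
/-- A path can be put in front of an eventually special path that starts at its range. -/
theorem exists_wordAct_pathWord (p : Γ.Path) (x : EventualPath γ) (hx : x.source = p.range) :
    ∃ y, wordAct (pathWord p) x = some y := by
  obtain ⟨v, l, h, hc⟩ := p
  simp only [wordAct_pathWord_eq_some]
  induction l generalizing v with
  | nil => exact ⟨x, rfl, hx⟩
  | cons e l ih =>
    obtain ⟨z, hz, hz'⟩ := ih (Γ.rng e) (by
        cases l with
        | nil => simp
        | cons f l => simpa [eq_comm] using (List.isChain_cons_cons.1 hc).1)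
      hc.tail (by
        refine hx.trans ?_
        cases l <;> simp [DirGraph.Path.range, List.getLast?_cons])
    obtain ⟨y, hy⟩ := act_edge_isSome hz'
    refine ⟨y, ?_, ?_⟩
    · simp only [List.map_cons, wordAct, hz, Option.bind_some, hy]
    · rw [(act_edge_source hy).2.1]
      exact h e (by simp)

/-- The pairs of paths whose products `p q*` form the set `B(γ)`. -/
def IsBasic (γ : Γ.Specialization) (p q : Γ.Path) : Prop :=
  p.range = q.range ∧
    ∀ e, p.edges.getLast? = some e → q.edges.getLast? = some e → ¬ γ.IsSpecial e

variable (F γ) in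
/-- The products `p q*` that form `B(γ)` are linearly independent. A vanishing combination of them
is tested on the matrix coefficient at `(q ξ, p ξ)`, where `ξ` is the special path that starts at
`r(p) = r(q)` and `(p, q)` has minimal length among the pairs that occur: no other pair that occurs
contributes to this coefficient. -/
theorem linearIndependent_monomial :
    LinearIndependent F fun t : {t : Γ.Path × Γ.Path // IsBasic γ t.1 t.2} =>
      monomial F γ t.1.1 t.1.2 := by
  rw [linearIndependent_iff]
  intro c hc
  by_contra hne
  obtain ⟨⟨⟨p, q⟩, hpq⟩, ht, hmin⟩ := c.support.exists_min_image
    (fun t => t.1.1.length + t.1.2.length) (Finsupp.support_nonempty_iff.2 hne)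
  let ξ : EventualPath γ := ⟨p.range, [], 0, isReduced_nil γ _⟩
  obtain ⟨z, hz⟩ := exists_wordAct_pathWord p ξ rfl
  obtain ⟨x, hx⟩ := exists_wordAct_pathWord q ξ hpq.1
  have hcoef := congrArg (fun a => rep F γ a (Finsupp.single x 1) z) hc
  simp only [Finsupp.linearCombination_apply, Finsupp.sum, map_sum, map_smul, LinearMap.sum_apply,
    LinearMap.smul_apply, Finsupp.finsetSum_apply, Finsupp.smul_apply, map_zero,
    LinearMap.zero_apply, Finsupp.zero_apply] at hcoef
  rw [Finset.sum_eq_single_of_mem _ ht] at hcoef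
  · rcases rep_monomial_apply (F := F) p q x z with ⟨-, h⟩ | ⟨h, -⟩
    · rw [h, smul_eq_mul, mul_one] at hcoef
      exact (Finsupp.mem_support_iff.1 ht) hcoef
    · exact h ⟨ξ, hx, hz⟩
  · rintro ⟨⟨p', q'⟩, hpq'⟩ ht' hne'
    rcases rep_monomial_apply (F := F) p' q' x z with ⟨⟨y, hy, hy'⟩, -⟩ | ⟨-, h⟩
    · exfalso
      rw [wordAct_pathWord_eq_some] at hx hz hy hy'
      have hlen := hmin _ ht'
      simp only [DirGraph.Path.length] at hlen
      have d₁ := wordAct_edges_label hx.1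
      have d₂ := wordAct_edges_label hz.1
      have d₃ := wordAct_edges_label hy.1
      have d₄ := wordAct_edges_label hy'.1
      obtain ⟨u, hu, hu'⟩ := exists_append_of_wordAct_eq (by lia) hx.1 hy.1
      obtain ⟨w, hw, hw'⟩ := exists_append_of_wordAct_eq (by lia) hz.1 hy'.1
      have e₁ := wordAct_edges_label hu'
      have e₂ := wordAct_edges_label hw'
      obtain ⟨rfl, hsp⟩ := eq_of_wordAct_eq_special (x := ξ) rfl (by lia) hu' hw'
      rcases List.eq_nil_or_concat u with rfl | ⟨u, e, rfl⟩
      · refine hne' (Subtype.ext (Prod.ext ?_ ?_))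
        · exact DirGraph.Path.ext (hy'.2.symm.trans hz.2) (by simpa using hw)
        · exact DirGraph.Path.ext (hy.2.symm.trans hx.2) (by simpa using hu)
      · refine hpq'.2 e ?_ ?_ (hsp e (by simp)) <;> simp [hu, hw, ← List.append_assoc]
    · rw [h, smul_zero]

end Representation

section Span

variable {F : Type w} [Field F] {V : Type u} {E : Type v} {Γ : DirGraph V E}

/-! ### Operations on paths -/

namespace DirGraph.Path

/-- The vertex `x` as a path of length `0`. -/
def nil (x : V) : Γ.Path := ⟨x, [], by simp, by simp⟩

/-- The path `e p`. -/
def cons (e : E) (p : Γ.Path) (h : Γ.rng e = p.source) : Γ.Path where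
  source := Γ.src e
  edges := e :: p.edges
  source_eq := by simp
  chain := List.isChain_cons.2 ⟨fun f hf => h.trans (p.source_eq f hf).symm, p.chain⟩

theorem range_of_edges_eq_nil {p : Γ.Path} (h : p.edges = []) : p.range = p.source := by
  simp [range, h]

theorem range_of_getLast? {p : Γ.Path} {e : E} (h : p.edges.getLast? = some e) :
    p.range = Γ.rng e := by
  simp [range, h]

/-- The path `p e`. -/
def snoc (p : Γ.Path) (e : E) (h : p.range = Γ.src e) : Γ.Path where
  source := p.source
  edges := p.edges ++ [e]
  source_eq := by
    cases hp : p.edges with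
    | nil => simpa [range_of_edges_eq_nil hp, eq_comm] using h
    | cons f l => simpa [hp] using p.source_eq
  chain := by
    refine List.isChain_append.2 ⟨p.chain, by simp, fun f hf g hg => ?_⟩
    obtain rfl : e = g := by simpa using hg
    exact (range_of_getLast? hf).symm.trans h

theorem range_snoc (p : Γ.Path) (e : E) (h : p.range = Γ.src e) :
    (p.snoc e h).range = Γ.rng e :=
  range_of_getLast? (by simp [snoc])

theorem exists_eq_snoc {p : Γ.Path} {e : E} (h : p.edges.getLast? = some e) :
    ∃ (p' : Γ.Path) (h' : p'.range = Γ.src e), p = p'.snoc e h' := by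
  obtain ⟨l, hl⟩ := List.getLast?_eq_some_iff.1 h
  have hc := List.isChain_append.1 (hl ▸ p.chain)
  refine ⟨⟨p.source, l, fun f hf => p.source_eq f ?_, hc.1⟩, ?_, Path.ext rfl hl⟩
  · rw [hl]
    exact List.mem_head?_append_of_mem_head? hf
  · rcases List.eq_nil_or_concat l with rfl | ⟨m, f, rfl⟩
    · simpa [range, eq_comm] using p.source_eq e (by simp [hl])
    · rw [range_of_getLast? (e := f) (by simp)]
      exact hc.2.2 f (by simp) e (by simp)

theorem exists_eq_cons {p : Γ.Path} {e : E} {l : List E} (h : p.edges = e :: l) :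
    ∃ (p' : Γ.Path) (h' : Γ.rng e = p'.source), p = p'.cons e h' := by
  have hc := List.isChain_cons.1 (h ▸ p.chain)
  exact ⟨⟨Γ.rng e, l, fun f hf => (hc.1 f hf).symm, hc.2⟩, rfl,
    Path.ext (p.source_eq e (by simp [h])).symm h⟩

theorem length_snoc (p : Γ.Path) (e : E) (h : p.range = Γ.src e) :
    (p.snoc e h).length = p.length + 1 := by
  simp [length, snoc]

theorem sd_snoc_of_isSpecial {γ : Γ.Specialization} (p : Γ.Path) {e : E} (h : p.range = Γ.src e)
    (he : γ.IsSpecial e) : (p.snoc e h).sd γ = p.sd γ + 1 := by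
  simp [sd, snoc, he]

theorem sd_snoc_of_not_isSpecial {γ : Γ.Specialization} (p : Γ.Path) {e : E}
    (h : p.range = Γ.src e) (he : ¬ γ.IsSpecial e) : (p.snoc e h).sd γ = 0 := by
  simp [sd, snoc, he]

end DirGraph.Path

/-! ### Products of paths and generators -/

variable [Fintype V] [Fintype E] {γ : Γ.Specialization}

theorem mk_eq_of_rel {a b : FreeAlgebra F (Gen V E)} (h : Rel F Γ a b) : mk F γ a = mk F γ b :=
  RingQuot.mkAlgHom_rel F h

theorem gen_vert_mul_self (x : V) : gen F γ (.vert x) * gen F γ (.vert x) = gen F γ (.vert x) := by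
  simpa [gen] using mk_eq_of_rel (γ := γ) (Rel.vert_idem (F := F) x)

theorem gen_vert_mul_of_ne {x y : V} (h : x ≠ y) :
    gen F γ (.vert x) * gen F γ (.vert y) = 0 := by
  simpa [gen] using mk_eq_of_rel (γ := γ) (Rel.vert_orth (F := F) x y h)

theorem gen_src_mul_edge (e : E) :
    gen F γ (.vert (Γ.src e)) * gen F γ (.edge e) = gen F γ (.edge e) := by
  simpa [gen] using mk_eq_of_rel (γ := γ) (Rel.src_edge (F := F) e)

theorem gen_edge_mul_rng (e : E) :
    gen F γ (.edge e) * gen F γ (.vert (Γ.rng e)) = gen F γ (.edge e) := by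
  simpa [gen] using mk_eq_of_rel (γ := γ) (Rel.edge_rng (F := F) e)

theorem gen_rng_mul_ghost (e : E) :
    gen F γ (.vert (Γ.rng e)) * gen F γ (.ghost e) = gen F γ (.ghost e) := by
  simpa [gen] using mk_eq_of_rel (γ := γ) (Rel.rng_ghost (F := F) e)

theorem gen_ghost_mul_src (e : E) :
    gen F γ (.ghost e) * gen F γ (.vert (Γ.src e)) = gen F γ (.ghost e) := by
  simpa [gen] using mk_eq_of_rel (γ := γ) (Rel.ghost_src (F := F) e)

theorem gen_ghost_mul_edge (e : E) :
    gen F γ (.ghost e) * gen F γ (.edge e) = gen F γ (.vert (Γ.rng e)) := by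
  simpa [gen] using mk_eq_of_rel (γ := γ) (Rel.ghost_edge (F := F) e)

theorem gen_ghost_mul_edge_of_ne {e f : E} (h : e ≠ f) :
    gen F γ (.ghost e) * gen F γ (.edge f) = 0 := by
  simpa [gen] using mk_eq_of_rel (γ := γ) (Rel.ghost_edge_ne (F := F) e f h)

open Classical in
theorem gen_vert_eq_sum {x : V} (hx : ¬ Γ.IsSink x) :
    gen F γ (.vert x) = ∑ e ∈ Finset.univ.filter (fun e : E => Γ.src e = x),
      gen F γ (.edge e) * gen F γ (.ghost e) := by
  simpa [gen] using mk_eq_of_rel (γ := γ) (Rel.vert_eq_sum (F := F) x hx)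

variable (F γ) in
theorem sum_gen_vert : ∑ x : V, gen F γ (.vert x) = 1 := by
  simpa [gen] using mk_eq_of_rel (γ := γ) (Rel.unit (F := F) (Γ := Γ))

theorem word_cons (g : Gen V E) (l : List (Gen V E)) :
    word F γ (g :: l) = gen F γ g * word F γ l := by
  simp [word]

theorem word_pathWord_nil (x : V) :
    word F γ (pathWord (DirGraph.Path.nil x : Γ.Path)) = gen F γ (.vert x) := by
  simp [word, pathWord, DirGraph.Path.nil]

theorem word_ghostWord_nil (x : V) :
    word F γ (ghostWord (DirGraph.Path.nil x : Γ.Path)) = gen F γ (.vert x) := by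
  simp [word, ghostWord, DirGraph.Path.nil]

theorem word_pathWord_snoc (p : Γ.Path) (e : E) (h : p.range = Γ.src e) :
    word F γ (pathWord (p.snoc e h)) = word F γ (pathWord p) * gen F γ (.edge e) := by
  simp [word, pathWord, DirGraph.Path.snoc, mul_assoc]

theorem word_ghostWord_snoc (p : Γ.Path) (e : E) (h : p.range = Γ.src e) :
    word F γ (ghostWord (p.snoc e h)) = gen F γ (.ghost e) * word F γ (ghostWord p) := by
  simp [word, ghostWord, DirGraph.Path.snoc]

theorem gen_source_mul_pathWord (p : Γ.Path) :
    gen F γ (.vert p.source) * word F γ (pathWord p) = word F γ (pathWord p) := by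
  rw [pathWord, word_cons, ← mul_assoc, gen_vert_mul_self]

theorem gen_vert_mul_pathWord_of_ne {p : Γ.Path} {x : V} (h : x ≠ p.source) :
    gen F γ (.vert x) * word F γ (pathWord p) = 0 := by
  rw [← gen_source_mul_pathWord, ← mul_assoc, gen_vert_mul_of_ne h, zero_mul]

theorem word_pathWord_cons (p : Γ.Path) (e : E) (h : Γ.rng e = p.source) :
    word F γ (pathWord (p.cons e h)) = gen F γ (.edge e) * word F γ (pathWord p) := by
  simp only [pathWord, DirGraph.Path.cons, List.map_cons, word_cons, ← mul_assoc,
    gen_src_mul_edge, ← h, gen_edge_mul_rng]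

theorem pathWord_mul_range (p : Γ.Path) :
    word F γ (pathWord p) * gen F γ (.vert p.range) = word F γ (pathWord p) := by
  cases h : p.edges.getLast? with
  | none =>
    obtain h := List.getLast?_eq_none_iff.1 h
    rw [DirGraph.Path.range_of_edges_eq_nil h]
    simp [word, pathWord, h, gen_vert_mul_self]
  | some e =>
    obtain ⟨p, h', rfl⟩ := DirGraph.Path.exists_eq_snoc h
    rw [DirGraph.Path.range_snoc, word_pathWord_snoc, mul_assoc, gen_edge_mul_rng]

theorem range_mul_ghostWord (p : Γ.Path) :
    gen F γ (.vert p.range) * word F γ (ghostWord p) = word F γ (ghostWord p) := by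
  cases h : p.edges.getLast? with
  | none =>
    obtain h := List.getLast?_eq_none_iff.1 h
    rw [DirGraph.Path.range_of_edges_eq_nil h]
    simp [word, ghostWord, h, gen_vert_mul_self]
  | some e =>
    obtain ⟨p, h', rfl⟩ := DirGraph.Path.exists_eq_snoc h
    rw [DirGraph.Path.range_snoc, word_ghostWord_snoc, ← mul_assoc, gen_rng_mul_ghost]

theorem monomial_eq_zero {p q : Γ.Path} (h : p.range ≠ q.range) : monomial F γ p q = 0 := by
  rw [monomial, ← pathWord_mul_range, ← range_mul_ghostWord, mul_assoc, ← mul_assoc (gen F γ _),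
    gen_vert_mul_of_ne h, zero_mul, mul_zero]

open Classical in
/-- The expansion of `p q*` at the common range `x` of `p` and `q`, given by `x = ∑ e e*`. -/
theorem monomial_eq_sum {p q : Γ.Path} (hpq : p.range = q.range) (hp : ¬ Γ.IsSink p.range) :
    monomial F γ p q = ∑ e : {e : E // Γ.src e = p.range},
      monomial F γ (p.snoc e e.2.symm) (q.snoc e (hpq.symm.trans e.2.symm)) := by
  rw [monomial, ← pathWord_mul_range, gen_vert_eq_sum hp, Finset.mul_sum, Finset.sum_mul,
    Finset.sum_subtype (F := inferInstance) _ (p := fun e => Γ.src e = p.range) (by simp)]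
  refine Finset.sum_congr rfl fun e _ => ?_
  rw [monomial, word_pathWord_snoc, word_ghostWord_snoc]
  simp only [mul_assoc]

/-! ### Spanning -/

/-- The products `p q*` span a left ideal. -/
theorem gen_mul_monomial_mem (g : Gen V E) (p q : Γ.Path) :
    gen F γ g * monomial F γ p q ∈
      Submodule.span F (Set.range fun t : Γ.Path × Γ.Path => monomial F γ t.1 t.2) := by
  have hmem : ∀ p q : Γ.Path, monomial F γ p q ∈
      Submodule.span F (Set.range fun t : Γ.Path × Γ.Path => monomial F γ t.1 t.2) :=
    fun p q => Submodule.subset_span ⟨(p, q), rfl⟩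
  by_cases hpq : p.range = q.range
  swap
  · rw [monomial_eq_zero hpq, mul_zero]
    exact Submodule.zero_mem _
  cases g with
  | vert x =>
    by_cases hx : x = p.source
    · rw [hx, monomial, ← mul_assoc, gen_source_mul_pathWord]
      exact hmem p q
    · rw [monomial, ← mul_assoc, gen_vert_mul_pathWord_of_ne hx, zero_mul]
      exact Submodule.zero_mem _
  | edge e =>
    by_cases he : Γ.rng e = p.source
    · rw [monomial, ← mul_assoc, ← word_pathWord_cons p e he]
      exact hmem _ q
    · rw [monomial, ← mul_assoc, ← gen_edge_mul_rng, mul_assoc (gen F γ (.edge e)),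
        gen_vert_mul_pathWord_of_ne he, mul_zero, zero_mul]
      exact Submodule.zero_mem _
  | ghost e =>
    cases hp : p.edges with
    | nil =>
      have hr := DirGraph.Path.range_of_edges_eq_nil hp
      have hw : word F γ (pathWord p) = gen F γ (.vert p.source) := by simp [word, pathWord, hp]
      by_cases he : Γ.src e = p.source
      · have hm : gen F γ (.ghost e) * monomial F γ p q =
            monomial F γ (.nil (Γ.rng e)) (q.snoc e (hpq.symm.trans (hr.trans he.symm))) := by
          rw [monomial, monomial, hw, word_pathWord_nil, word_ghostWord_snoc, ← he, ← mul_assoc,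
            ← mul_assoc, gen_ghost_mul_src, gen_rng_mul_ghost]
        rw [hm]
        exact hmem _ _
      · rw [monomial, ← mul_assoc, ← gen_ghost_mul_src, mul_assoc (gen F γ (.ghost e)),
          gen_vert_mul_pathWord_of_ne he, mul_zero, zero_mul]
        exact Submodule.zero_mem _
    | cons f l =>
      obtain ⟨p, h, rfl⟩ := DirGraph.Path.exists_eq_cons hp
      rw [monomial, word_pathWord_cons, ← mul_assoc, ← mul_assoc]
      by_cases he : e = f
      · subst he
        rw [gen_ghost_mul_edge, h, gen_source_mul_pathWord]
        exact hmem p q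
      · rw [gen_ghost_mul_edge_of_ne he, zero_mul, zero_mul]
        exact Submodule.zero_mem _

variable (F γ) in
theorem span_range_monomial :
    Submodule.span F (Set.range fun t : Γ.Path × Γ.Path => monomial F γ t.1 t.2) = ⊤ := by
  have hword : ∀ l : List (Gen V E), word F γ l ∈
      Submodule.span F (Set.range fun t : Γ.Path × Γ.Path => monomial F γ t.1 t.2) := by
    intro l
    induction l with
    | nil =>
      have h : word F γ [] = ∑ x : V, monomial F γ (.nil x : Γ.Path) (.nil x) := by
        simp only [monomial, word_pathWord_nil, word_ghostWord_nil, gen_vert_mul_self, sum_gen_vert]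
        simp [word]
      rw [h]
      exact Submodule.sum_mem _ fun x _ => Submodule.subset_span ⟨(.nil x, .nil x), rfl⟩
    | cons g l ih =>
      rw [word_cons]
      generalize word F γ l = a at ih ⊢
      induction ih using Submodule.span_induction with
      | mem a ha =>
        obtain ⟨t, rfl⟩ := ha
        exact gen_mul_monomial_mem g t.1 t.2
      | zero => simp
      | add a b _ _ ha hb => rw [mul_add]; exact Submodule.add_mem _ ha hb
      | smul c a _ ha => rw [mul_smul_comm]; exact Submodule.smul_mem _ _ ha
  refine eq_top_iff.2 fun a _ => ?_
  obtain ⟨x, rfl⟩ := RingQuot.mkAlgHom_surjective F (Rel F Γ) a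
  have h := mk_mul_mem_span_word F γ x 1 (Submodule.subset_span ⟨[], rfl⟩)
  rw [mul_one] at h
  refine Submodule.span_le.2 ?_ h
  rintro _ ⟨l, rfl⟩
  exact hword l

/-- The pairs `(p, q)` with `k (sd(p) + sd(q) + |l(p) - l(q)| + 1) ≤ l(p) + l(q) + c`. For `c = 0`
the products `p q*` of these pairs span `V_k`; with `k = 1` and `c` large enough, the set contains
any given pair. -/
def depthSet (γ : Γ.Specialization) (k c : ℝ) : Set (Γ.Path × Γ.Path) :=
  {t | k * ((t.1.sd γ : ℝ) + t.2.sd γ + |(t.1.length : ℝ) - t.2.length| + 1) ≤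
    (t.1.length : ℝ) + t.2.length + c}

omit [Fintype V] [Fintype E] in
theorem mem_depthSet {k c : ℝ} {p q : Γ.Path} : (p, q) ∈ depthSet γ k c ↔
    k * ((p.sd γ : ℝ) + q.sd γ + |(p.length : ℝ) - q.length| + 1) ≤
      (p.length : ℝ) + q.length + c :=
  Iff.rfl

/-- If `p = p' g` and `q = q' g` with a special edge `g`, then `p q*` is `p' q'*` minus the sum of
the products `p' f (q' f)*` over the other edges `f` that start where `g` does. All these products
are at least as deep as `p q*`, because `k ≥ 1`: the first one loses `2` in length and `2` in the
lengths of the special ends. Repeating this step writes `p q*` in terms of the set `B(γ)`. -/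
theorem monomial_mem_span_isBasic {k c : ℝ} (hk : 1 ≤ k) {p q : Γ.Path}
    (hpq : p.range = q.range) (h : (p, q) ∈ depthSet γ k c) :
    monomial F γ p q ∈ Submodule.span F ((fun t : Γ.Path × Γ.Path => monomial F γ t.1 t.2) ''
      {t | IsBasic γ t.1 t.2 ∧ t ∈ depthSet γ k c}) := by
  classical
  induction hn : p.length generalizing p q with
  | zero =>
    refine Submodule.subset_span ⟨(p, q), ⟨⟨hpq, fun e he => ?_⟩, h⟩, rfl⟩
    simp [List.length_eq_zero_iff.1 hn] at he
  | succ n ih =>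
    by_cases hb : ∀ e, p.edges.getLast? = some e → q.edges.getLast? = some e → ¬ γ.IsSpecial e
    · exact Submodule.subset_span ⟨(p, q), ⟨⟨hpq, hb⟩, h⟩, rfl⟩
    push Not at hb
    obtain ⟨g, hp, hq, hg⟩ := hb
    obtain ⟨p, hpg, rfl⟩ := DirGraph.Path.exists_eq_snoc hp
    obtain ⟨q, hqg, rfl⟩ := DirGraph.Path.exists_eq_snoc hq
    have hpq' : p.range = q.range := hpg.trans hqg.symm
    have hsum := monomial_eq_sum (F := F) (γ := γ) hpq' fun hs => hs g hpg.symm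
    rw [← Finset.add_sum_erase _ _ (Finset.mem_univ ⟨g, hpg.symm⟩), ← sub_eq_iff_eq_add] at hsum
    rw [← hsum]
    simp only [mem_depthSet, DirGraph.Path.sd_snoc_of_isSpecial _ _ hg,
      DirGraph.Path.length_snoc, Nat.cast_add, Nat.cast_one, add_sub_add_right_eq_sub] at h
    refine Submodule.sub_mem _ (ih hpq' ?_ ?_) (Submodule.sum_mem _ fun f hf => ?_)
    · rw [mem_depthSet]
      nlinarith
    · simpa [DirGraph.Path.length_snoc] using hn
    · have hfs : ¬ γ.IsSpecial f.1 := fun hfs => Finset.ne_of_mem_erase hf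
        (Subtype.ext (hfs.eq_of_src_eq hg (f.2.trans hpg)))
      refine Submodule.subset_span ⟨(p.snoc f f.2.symm, q.snoc f (hpq'.symm.trans f.2.symm)),
        ⟨⟨?_, fun e he _ => ?_⟩, ?_⟩, rfl⟩
      · rw [DirGraph.Path.range_snoc, DirGraph.Path.range_snoc]
      · obtain rfl : f.1 = e := by simpa [DirGraph.Path.snoc] using he
        exact hfs
      · simp only [mem_depthSet, DirGraph.Path.sd_snoc_of_not_isSpecial _ _ hfs,
          DirGraph.Path.length_snoc, Nat.cast_add, Nat.cast_one, add_sub_add_right_eq_sub,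
          Nat.cast_zero]
        have h₁ : (0 : ℝ) ≤ p.sd γ := Nat.cast_nonneg _
        have h₂ : (0 : ℝ) ≤ q.sd γ := Nat.cast_nonneg _
        nlinarith

variable (F γ) in
/-- `B(γ)` is a basis of the vector space `L(Γ)`, indexed by the pairs of paths. -/
def pairBasis : Module.Basis {t : Γ.Path × Γ.Path // IsBasic γ t.1 t.2} F (Leavitt F Γ γ) :=
  Module.Basis.mk (linearIndependent_monomial F γ) <| by
    rw [← span_range_monomial F γ, Submodule.span_le]
    rintro _ ⟨⟨p, q⟩, rfl⟩
    simp only [SetLike.mem_coe]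
    by_cases hpq : p.range = q.range
    · have h : (p, q) ∈ depthSet γ 1
          ((p.sd γ : ℝ) + q.sd γ + |(p.length : ℝ) - q.length| + 1) := by
        simp only [mem_depthSet, one_mul]
        linarith [(p.length.cast_nonneg : (0 : ℝ) ≤ p.length),
          (q.length.cast_nonneg : (0 : ℝ) ≤ q.length)]
      refine Submodule.span_mono ?_ (monomial_mem_span_isBasic le_rfl hpq h)
      rintro _ ⟨t, ht, rfl⟩
      exact ⟨⟨t, ht.1⟩, rfl⟩
    · rw [monomial_eq_zero hpq]
      exact Submodule.zero_mem _

theorem pairBasis_apply (t : {t : Γ.Path × Γ.Path // IsBasic γ t.1 t.2}) :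
    pairBasis F γ t = monomial F γ t.1.1 t.1.2 := by
  simp [pairBasis]

theorem monomial_mem_Vk {k : ℝ} {p q : Γ.Path} (h : (p, q) ∈ depthSet γ k 0) :
    monomial F γ p q ∈ Vk F γ k := by
  simp only [mem_depthSet, add_zero] at h
  refine Submodule.mem_iSup_of_mem ⟨((p.length : ℝ) + q.length, (p.sd γ : ℝ) + q.sd γ,
    |(p.length : ℝ) - q.length|), by positivity, by positivity, by positivity, h⟩ ?_
  exact Submodule.subset_span ⟨p, q, le_rfl, le_rfl, le_rfl, rfl⟩

/-- `V_k` is spanned by the elements of `B(γ)` that it contains by definition. -/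
theorem Vk_eq_span {k : ℝ} (hk : 1 ≤ k) :
    Vk F γ k = Submodule.span F (pairBasis F γ '' {t | t.1 ∈ depthSet γ k 0}) := by
  refine le_antisymm (iSup_le ?_) (Submodule.span_le.2 ?_)
  · rintro ⟨⟨n, s, d⟩, hn, hs, hd, ht⟩
    refine Submodule.span_le.2 ?_
    rintro _ ⟨p, q, h₁, h₂, h₃, rfl⟩
    simp only [SetLike.mem_coe] at hn hs hd ht h₁ h₂ h₃ ⊢
    by_cases hpq : p.range = q.range
    · have h : (p, q) ∈ depthSet γ k 0 := by
        simp only [mem_depthSet, add_zero]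
        nlinarith
      refine Submodule.span_mono ?_ (monomial_mem_span_isBasic hk hpq h)
      rintro _ ⟨t, ht, rfl⟩
      exact ⟨⟨t, ht.1⟩, ht.2, pairBasis_apply _⟩
    · rw [monomial_eq_zero hpq]
      exact Submodule.zero_mem _
  · rintro _ ⟨t, ht, rfl⟩
    rw [pairBasis_apply]
    exact monomial_mem_Vk ht

end Span

section Topology

open scoped Topology

variable {F : Type w} [Field F] {V : Type u} {E : Type v} {Γ : DirGraph V E}
  [Fintype V] [Fintype E] {γ : Γ.Specialization}

/-! ### Coordinates and the topology -/

variable (F γ) in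
theorem range_pairBasis : Set.range (pairBasis F γ) = B F γ := by
  ext a
  constructor
  · rintro ⟨⟨⟨p, q⟩, h⟩, rfl⟩
    exact ⟨p, q, h.1, h.2, pairBasis_apply _⟩
  · rintro ⟨p, q, h, h', rfl⟩
    exact ⟨⟨(p, q), h, h'⟩, pairBasis_apply _⟩

variable (F γ) in
/-- `B(γ)` as a basis of the vector space `L(Γ)`. -/
def basisB : Module.Basis (B F γ) F (Leavitt F Γ γ) :=
  (pairBasis F γ).reindexRange.reindex (Equiv.setCongr (range_pairBasis F γ))

theorem basisB_apply (b : B F γ) : basisB F γ b = b := by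
  simp [basisB, Module.Basis.reindexRange_apply]

/-- Every `V_k` is a coordinate subspace with respect to `B(γ)`. -/
theorem basisB_repr_eq_zero {k : ℝ} (hk : 1 ≤ k) {a : Leavitt F Γ γ} (ha : a ∈ Vk F γ k)
    {b : B F γ} (hb : (b : Leavitt F Γ γ) ∉ Vk F γ k) : (basisB F γ).repr a b = 0 := by
  have h : Vk F γ k ≤ Submodule.span F (basisB F γ '' {b | (b : Leavitt F Γ γ) ∈ Vk F γ k}) := by
    rw [Vk_eq_span hk]
    refine Submodule.span_mono ?_
    rintro _ ⟨t, ht, rfl⟩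
    exact ⟨⟨pairBasis F γ t, range_pairBasis F γ ▸ Set.mem_range_self t⟩,
      Submodule.subset_span (Set.mem_image_of_mem _ ht), basisB_apply _⟩
  by_contra hne
  exact hb ((basisB F γ).mem_span_image.1 (h ha) (Finsupp.mem_support_iff.2 hne))

theorem mem_depthSet_of_mem_Vk {k : ℝ} (hk : 1 ≤ k)
    {t : {t : Γ.Path × Γ.Path // IsBasic γ t.1 t.2}} (h : pairBasis F γ t ∈ Vk F γ k) :
    t.1 ∈ depthSet γ k 0 := by
  rw [Vk_eq_span hk, Module.Basis.mem_span_image] at h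
  have ht : t ∈ ((pairBasis F γ).repr (pairBasis F γ t)).support := by simp
  exact h ht

theorem exists_notMem_Vk (b : B F γ) : ∃ k : ℝ, 1 ≤ k ∧ (b : Leavitt F Γ γ) ∉ Vk F γ k := by
  obtain ⟨t, ht⟩ : (b : Leavitt F Γ γ) ∈ Set.range (pairBasis F γ) := by
    rw [range_pairBasis]
    exact b.2
  rw [← ht]
  obtain ⟨⟨p, q⟩, hpq⟩ := t
  have h₁ : (0 : ℝ) ≤ p.length := Nat.cast_nonneg _
  have h₂ : (0 : ℝ) ≤ q.length := Nat.cast_nonneg _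
  have h₃ : (0 : ℝ) ≤ (p.sd γ : ℝ) + q.sd γ + |(p.length : ℝ) - q.length| := by positivity
  have hk : (1 : ℝ) ≤ p.length + q.length + 1 := by linarith
  refine ⟨p.length + q.length + 1, hk, fun h => ?_⟩
  have h' := mem_depthSet.1 (mem_depthSet_of_mem_Vk hk h)
  nlinarith

/-- The coordinates with respect to `B(γ)` extend to the completion of `L(Γ)`, continuously for the
discrete topology of `F`. -/
theorem exists_coord (b : B F γ) : ∃ f : Compl F γ →+ F,
    (∀ a : Leavitt F Γ γ, f (toCompl F γ a) = (basisB F γ).repr a b) ∧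
      Continuous[_, ⊥] f := by
  let _ : UniformSpace F := ⊥
  have _ : DiscreteUniformity F := ⟨rfl⟩
  have _ : DiscreteTopology F := inferInstance
  have _ : IsUniformAddGroup F := inferInstance
  let g : Leavitt F Γ γ →+ F := ((basisB F γ).coord b).toAddMonoidHom
  have hg : Continuous g := by
    refine continuous_of_continuousAt_zero g ?_
    obtain ⟨k, hk, hb⟩ := exists_notMem_Vk b
    rw [ContinuousAt, map_zero, nhds_discrete F, Filter.tendsto_pure]
    exact (nhds_zero_hasBasis F γ).mem_iff.2 ⟨k, hk, fun a ha => basisB_repr_eq_zero hk ha hb⟩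
  refine ⟨g.extension hg, fun a => AddMonoidHom.extension_coe g hg a, ?_⟩
  exact g.continuous_extension hg

variable (F γ) in
theorem denseRange_toCompl : DenseRange (toCompl F γ) :=
  UniformSpace.Completion.denseRange_coe

/-- The closures of the subspaces `V_k` form a basis of neighbourhoods of `0` in the completion. -/
theorem exists_closure_Vk_subset {U : Set (Compl F γ)} (hU : U ∈ nhds 0) :
    ∃ k : ℝ, 1 ≤ k ∧ closure (toCompl F γ '' Vk F γ k) ⊆ U := by
  obtain ⟨W, hW, hWc, hWU⟩ := exists_mem_nhds_isClosed_subset hU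
  have h : toCompl F γ ⁻¹' W ∈ nhds 0 :=
    (UniformSpace.Completion.continuous_coe _).continuousAt.preimage_mem_nhds
      (by rwa [UniformSpace.Completion.coe_zero])
  obtain ⟨k, hk, hkW⟩ := (nhds_zero_hasBasis F γ).mem_iff.1 h
  exact ⟨k, hk, (closure_minimal (Set.image_subset_iff.2 hkW) hWc).trans hWU⟩

theorem closure_Vk_mem_nhds {k : ℝ} (hk : 1 ≤ k) :
    closure (toCompl F γ '' Vk F γ k) ∈ nhds 0 := by
  have h := UniformSpace.Completion.isDenseInducing_coe.closure_image_mem_nhds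
    ((nhds_zero_hasBasis F γ).mem_of_mem hk)
  rwa [UniformSpace.Completion.coe_zero] at h

/-- Every element of the completion is the sum of the series given by its coordinates. Modulo the
closure of `V_k` it equals some `a ∈ L(Γ)`, and then it has the coordinates of `a` outside `V_k`, so
that all partial sums over finite sets that contain the support of `a` are congruent to it. -/
theorem hasSum_coord {f : B F γ → Compl F γ →+ F}
    (hf : ∀ b, ∀ a : Leavitt F Γ γ, f b (toCompl F γ a) = (basisB F γ).repr a b)
    (hc : ∀ b, Continuous[_, ⊥] (f b)) (x : Compl F γ) :
    HasSum (fun b => f b x • toCompl F γ b) x := by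
  let _ : TopologicalSpace F := ⊥
  have _ : DiscreteTopology F := ⟨rfl⟩
  rw [HasSum, SummationFilter.unconditional_filter, ← tendsto_sub_nhds_zero_iff]
  intro U hU
  obtain ⟨k, hk, hkU⟩ := exists_closure_Vk_subset hU
  let K : Submodule F (Compl F γ) := ((Vk F γ k).map (toCompl F γ)).topologicalClosure
  have hK : (K : Set (Compl F γ)) = closure (toCompl F γ '' Vk F γ k) := by
    simp [K, Submodule.topologicalClosure_coe]
  have hVK : ∀ a ∈ Vk F γ k, toCompl F γ a ∈ K := fun a ha =>
    Submodule.le_topologicalClosure _ (Submodule.mem_map_of_mem ha)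
  have hcoord : ∀ y ∈ K, ∀ b : B F γ, (b : Leavitt F Γ γ) ∉ Vk F γ k → f b y = 0 := by
    intro y hy b hb
    have hcl : IsClosed {y | f b y = 0} := isClosed_singleton.preimage (hc b)
    refine closure_minimal ?_ hcl (hK ▸ hy : y ∈ closure (toCompl F γ '' Vk F γ k))
    rintro _ ⟨a, ha, rfl⟩
    exact (hf b a).trans (basisB_repr_eq_zero hk ha hb)
  obtain ⟨a, ha⟩ : ∃ a, x - toCompl F γ a ∈ K := by
    have hn : (fun y => x - y) ⁻¹' (K : Set (Compl F γ)) ∈ nhds x := by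
      refine (continuous_const.sub continuous_id').continuousAt.preimage_mem_nhds ?_
      simpa only [hK, Pi.sub_apply, sub_self] using closure_Vk_mem_nhds hk
    obtain ⟨_, ⟨a, rfl⟩, ha⟩ := (denseRange_toCompl F γ).inter_nhds_nonempty hn
    exact ⟨a, ha⟩
  refine Filter.mem_map.2 ?_
  filter_upwards [Filter.eventually_ge_atTop ((basisB F γ).repr a).support] with S hS
  refine hkU (hK ▸ ?_)
  have hsum : ∑ b ∈ S, (basisB F γ).repr a b • toCompl F γ b = toCompl F γ a := by
    conv_rhs => rw [← (basisB F γ).linearCombination_repr a, Finsupp.linearCombination_apply,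
      Finsupp.sum_of_support_subset _ hS _ (by simp)]
    simp [basisB_apply]
  have hsplit : ∑ b ∈ S, f b x • toCompl F γ b - x =
      ∑ b ∈ S, f b (x - toCompl F γ a) • toCompl F γ b - (x - toCompl F γ a) := by
    simp only [map_sub, hf, sub_smul, Finset.sum_sub_distrib, hsum]
    abel
  beta_reduce
  rw [SetLike.mem_coe, hsplit]
  refine K.sub_mem (K.sum_mem fun b _ => ?_) ha
  by_cases hb : (b : Leavitt F Γ γ) ∈ Vk F γ k
  · exact K.smul_mem _ (hVK _ hb)
  · rw [hcoord _ ha b hb, zero_smul]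
    exact K.zero_mem

/-- The coefficients of a series in `B(γ)` are the coordinates of its sum. -/
theorem eq_coord_of_hasSum {f : Compl F γ →+ F} {b : B F γ}
    (hf : ∀ a : Leavitt F Γ γ, f (toCompl F γ a) = (basisB F γ).repr a b)
    (hc : Continuous[_, ⊥] f) {α : B F γ → F} {x : Compl F γ}
    (h : HasSum (fun b => α b • toCompl F γ b) x) : α b = f x := by
  classical
  let _ : TopologicalSpace F := ⊥
  have _ : DiscreteTopology F := ⟨rfl⟩
  have h' := h.map f hc
  have hterm : ∀ b', f (α b' • toCompl F γ b') = if b' = b then α b else 0 := by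
    intro b'
    rw [← map_smul, hf, ← basisB_apply, map_smul, Module.Basis.repr_self, Finsupp.smul_apply,
      Finsupp.single_apply]
    split_ifs with hb
    · simp [hb]
    · simp
  have h'' : HasSum (fun b' => if b' = b then α b else 0) (f x) := by
    simpa only [Function.comp_def, hterm] using h'
  exact (hasSum_ite_eq b (α b)).unique h''

end Topology

end LPA

end

theorem lemma6 {F : Type*} [Field F] {V : Type*} {E : Type*} [Fintype V] [Fintype E]
    (Γ : LPA.DirGraph V E) (γ : Γ.Specialization) (x : LPA.gradedCompl F γ) :
    ∃! α : LPA.B F γ → F,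
      HasSum (fun b : LPA.B F γ => α b • LPA.toGradedCompl F γ b) x := by
  have hiff : ∀ α : LPA.B F γ → F,
      HasSum (fun b : LPA.B F γ => α b • LPA.toGradedCompl F γ b) x ↔
        HasSum (fun b : LPA.B F γ => α b • LPA.toCompl F γ b) (x : LPA.Compl F γ) := fun α =>
    (Topology.IsInducing.subtypeVal.hasSum_iff (g := (LPA.gradedCompl F γ).subtype) _ _).symm
  choose f hf hc using LPA.exists_coord (F := F) (γ := γ)
  refine ⟨fun b => f b x, (hiff _).2 (LPA.hasSum_coord hf hc x), fun α hα => funext fun b => ?_⟩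
  exact LPA.eq_coord_of_hasSum (hf b) (hc b) ((hiff α).1 hα)
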